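/- Let $I=[-1,1]$, $K\in C(I^2)$ and $f\in C(I)$ be complex-valued, $\kappa\ge 1$, $(\mathcal K h)(s)=\int_I K(s,t)e^{i\kappa|s-t|}h(t)\,dt$, and let $y\in C(I)$ satisfy $(\mathcal I-\mathcal K)y=f$ on $I$. Let $m\ge 0$ be an integer and suppose that $y(s)=u_1(s)+u_2(s)e^{i\kappa s}+u_3(s)e^{-i\kappa s}$ on $I$, where each $u_j$ is $m$ times differentiable on $I$ with $|u_j^{(l)}|\le\tau$ on $I$ for $0\le l\le m$ and some $\tau>0$. Let $\tilde\tau>0$ be such that for all $t\in I$ and $j=1,2,3$ the function $K(t,\cdot)u_j$ is $m$ times differentiable on $I$ with $|(K(t,\cdot)u_j)^{(l)}(s)|\le\tilde\tau$ for all $s\in I$, $0\le l\le m$. Let $\Gamma\ge 0$, $\beta\ge 1$, $\gamma\ge\Gamma+3$, let $q\ge1$ be an integer, and put $p=\lceil\gamma\kappa^\beta\rceil$, $h=2/p$, $s_j=-1+jh$ $(0\le j\le p)$, $N=pq+1$, $x_j=-1+\frac{2(j-1)}{N-1}$ $(1\le j\le N)$, $\|g\|_N=\big(\frac1N\sum_{j=1}^N|g(x_j)|^2\big)^{1/2}$.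 Let $\mathcal K_p$ be the composite trapezoidal discretization of $\mathcal K$: with $k_j(s)=K(s,s_j)e^{i\kappa|s-s_j|}$, $$(\mathcal K_pF)(s)=\tfrac h2\Big[k_0(s)F(s_0)+2\sum_{j=1}^{p-1}k_j(s)F(s_j)+k_p(s)F(s_p)\Big].$$ Let $M_\kappa=I_N-\frac1pB_\kappa\in\mathbb C^{N\times N}$, where, with $\omega_\kappa=e^{2\kappa i/(qp)}$, the entry $b_{j,l}$ of $B_\kappa$ is $K(x_j,x_l)\omega_\kappa^{|j-l|}$ if $l\in\{1,N\}$, $2K(x_j,x_l)\omega_\kappa^{|j-l|}$ if $l=rq+1$ with $1\le r\le p-1$, and $0$ otherwise. Put $$\mathcal E(\gamma,\beta,\kappa,m)=\frac{132\tilde\tau}{5\gamma\kappa^\beta}+\frac{81\tilde\tau(\Gamma+3)^m}{5\gamma^m\kappa^{m(\beta-1)}}.$$ Let $\sigma:\mathbb R\to\mathbb R$ be continuous (applied componentwise to vectors), let $d_1,d_2,\dots$ be positive integers, $d_0=1$, and $\mathcal T\mathbf v=v_1+iv_2$ for $\mathbf v=(v_1,v_2)$ real. In the adaptive multi-grade algorithm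 with tolerance $\epsilon>0$ and at most $L\ge1$ grades, put $\tilde{\mathbf g}_0(s)=s$ and $\tilde e_0^*=f$. Grade $l\ge1$ chooses $W_1\in\mathbb R^{d_l\times d_{l-1}}$, $b_1\in\mathbb R^{d_l}$, $W_2\in\mathbb R^{2\times d_l}$, $b_2\in\mathbb R^2$ that minimize $$\big\|\tilde e_{l-1}^*-(\mathcal I-\mathcal K_p)\mathcal T\big(W_2\,\sigma(W_1\tilde{\mathbf g}_{l-1}(\cdot)+b_1)+b_2\big)\big\|_N^2$$ over all such parameters (a minimizer is assumed to exist). For the chosen minimizer put $\tilde{\mathbf g}_l=\sigma(W_1\tilde{\mathbf g}_{l-1}+b_1)$, $\tilde{\mathbf f}_l=W_2\tilde{\mathbf g}_l+b_2$, $\tilde e_l^*=\tilde e_{l-1}^*-(\mathcal I-\mathcal K_p)\mathcal T\tilde{\mathbf f}_l$ and $\tilde y_l^*=\sum_{j=1}^l\mathcal T\tilde{\mathbf f}_j$. Starting from grade $1$, the algorithm passes from grade $l$ to grade $l+1$ as long as $l<L$ and $\|\tilde e_l^*\|_N>\epsilon/(2\|M_\kappa^{-1}\|_2)$, where $\|\cdot\|_2$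 on matrices is the spectral norm. Theorem. Suppose that $M_\kappa$ is invertible and that the algorithm terminates at grade $l^*$ with $$\|\tilde e_{l^*}^*\|_N\le\frac{\epsilon}{2\|M_\kappa^{-1}\|_2}.$$ If also $\mathcal E(\gamma,\beta,\kappa,m)\le\|\tilde e_{l^*}^*\|_N$, then $\|y-\tilde y_{l^*}^*\|_N\le\epsilon$. -/

import Mathlib

namespace AMGDL

noncomputable section

/-! ### The integral equation -/

/-- The interval `I = [-1, 1]`. -/
def interval : Set ℝ := Set.Icc (-1) 1

/-- The oscillatory kernel `K(s, t) e^{iκ|s - t|}`. -/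
def oscKernel (K : ℝ → ℝ → ℂ) (κ s t : ℝ) : ℂ :=
  K s t * Complex.exp (Complex.I * ((κ * |s - t| : ℝ) : ℂ))

/-- The integral operator `(𝒦 h)(s) = ∫_I K(s, t) e^{iκ|s - t|} h(t) dt`. -/
def intOp (K : ℝ → ℝ → ℂ) (κ : ℝ) (h : ℝ → ℂ) (s : ℝ) : ℂ :=
  ∫ t in (-1 : ℝ)..1, oscKernel K κ s t * h t

/-- `y` is a solution in `C(I)` of the Fredholm equation `(ℐ - 𝒦) y = f` on `I`. -/
def IsSolution (K : ℝ → ℝ → ℂ) (κ : ℝ) (f y : ℝ → ℂ) : Prop :=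
  ContinuousOn y interval ∧ ∀ s ∈ interval, y s - intOp K κ y s = f s

/-! ### Regularity of the solution -/

/-- `g` is `m` times differentiable on `I` and `|g^{(l)}(s)| ≤ C` for all `s ∈ I`, `0 ≤ l ≤ m`
(one-sided derivatives at the end points). -/
def DerivBound (m : ℕ) (C : ℝ) (g : ℝ → ℂ) : Prop :=
  (∀ l < m, DifferentiableOn ℝ (iteratedDerivWithin l g interval) interval) ∧
  ∀ l ≤ m, ∀ s ∈ interval, ‖iteratedDerivWithin l g interval s‖ ≤ C

/-- `y(s) = u₁(s) + u₂(s) e^{iκs} + u₃(s) e^{-iκs}` on `I`, where the derivatives of the `u_j` up to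
order `m` are bounded by `τ` (the functions `u₁, u₂, u₃` are `u 0, u 1, u 2`). -/
def IsOscDecomposition (κ : ℝ) (m : ℕ) (τ : ℝ) (u : Fin 3 → ℝ → ℂ) (y : ℝ → ℂ) : Prop :=
  (∀ j, DerivBound m τ (u j)) ∧
  ∀ s ∈ interval, y s = u 0 s + u 1 s * Complex.exp (Complex.I * ((κ * s : ℝ) : ℂ))
    + u 2 s * Complex.exp (-(Complex.I * ((κ * s : ℝ) : ℂ)))

/-! ### Discretization -/

/-- `p_κ = ⌈γ κ^β⌉`. -/
def numNodes (γ β κ : ℝ) : ℕ := ⌈γ * κ ^ β⌉₊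

/-- The quadrature node `s_j = -1 + j h`, where `h = 2 / p`. -/
def quadNode (p j : ℕ) : ℝ := -1 + (j : ℝ) * (2 / (p : ℝ))

/-- The operator `𝒦_p` obtained from `𝒦` by the composite trapezoidal rule with `p + 1` nodes. -/
def quadOp (K : ℝ → ℝ → ℂ) (κ : ℝ) (p : ℕ) (F : ℝ → ℂ) (s : ℝ) : ℂ :=
  (((2 / (p : ℝ)) / 2 : ℝ) : ℂ) *
    (oscKernel K κ s (quadNode p 0) * F (quadNode p 0)
      + 2 * ∑ j ∈ Finset.Ico 1 p, oscKernel K κ s (quadNode p j) * F (quadNode p j)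
      + oscKernel K κ s (quadNode p p) * F (quadNode p p))

/-- The number of collocation points `N = p q + 1`. -/
def numColl (p q : ℕ) : ℕ := p * q + 1

/-- The collocation points `-1 + 2 j / (N - 1)`, numbered `j = 0, …, N - 1`. -/
def collPoint (p q : ℕ) (j : Fin (numColl p q)) : ℝ :=
  -1 + 2 * (j : ℝ) / ((numColl p q : ℝ) - 1)

/-- The discrete semi-norm `‖g‖_N = √((1 / N) ∑_j |g(x_j)|²)`. -/
def discNorm (p q : ℕ) (g : ℝ → ℂ) : ℝ :=
  Real.sqrt (1 / (numColl p q : ℝ) * ∑ j, ‖g (collPoint p q j)‖ ^ 2)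

/-- `ω_κ = e^{2κi / (q p)}`. -/
def omega (κ : ℝ) (p q : ℕ) : ℂ :=
  Complex.exp (((2 * κ / ((q : ℝ) * (p : ℝ)) : ℝ) : ℂ) * Complex.I)

/-- The matrix `B_κ`, with rows and columns numbered from `0` to `N - 1`. -/
def matB (K : ℝ → ℝ → ℂ) (κ : ℝ) (p q : ℕ) :
    Matrix (Fin (numColl p q)) (Fin (numColl p q)) ℂ :=
  Matrix.of fun j l =>
    if (l : ℕ) = 0 ∨ (l : ℕ) = numColl p q - 1 then
      K (collPoint p q j) (collPoint p q l) * omega κ p q ^ ((j : ℤ) - (l : ℤ)).natAbs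
    else if ∃ d ∈ Finset.Ico 1 p, (l : ℕ) = d * q then
      2 * K (collPoint p q j) (collPoint p q l) * omega κ p q ^ ((j : ℤ) - (l : ℤ)).natAbs
    else 0

/-- The system matrix `M_κ = 1 - B_κ / p`. -/
def matM (K : ℝ → ℝ → ℂ) (κ : ℝ) (p q : ℕ) :
    Matrix (Fin (numColl p q)) (Fin (numColl p q)) ℂ :=
  1 - ((p : ℂ)⁻¹) • matB K κ p q

/-- The spectral norm `‖A‖₂` of a matrix (operator norm for the Euclidean norm on `ℂ^n`). -/
def specNorm {n : ℕ} (A : Matrix (Fin n) (Fin n) ℂ) : ℝ :=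
  ‖Matrix.toEuclideanCLM (n := Fin n) (𝕜 := ℂ) A‖

/-- The quadrature error bound
`132 τ' / (5 γ κ^β) + 81 τ' (Γ + 3)^m / (5 γ^m κ^{m (β - 1)})`. -/
def quadBound (τ' Γ γ β κ : ℝ) (m : ℕ) : ℝ :=
  132 * τ' / (5 * γ * κ ^ β)
    + 81 * τ' * (Γ + 3) ^ m / (5 * γ ^ m * κ ^ ((m : ℝ) * (β - 1)))

/-! ### Shallow networks and the multi-grade model -/

/-- Parameters of a network `𝒩₂` with input dimension `a`, one hidden layer of width `b`, and output
dimension `2`. -/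
structure GradeParams (a b : ℕ) where
  W₁ : Matrix (Fin b) (Fin a) ℝ
  b₁ : Fin b → ℝ
  W₂ : Matrix (Fin 2) (Fin b) ℝ
  b₂ : Fin 2 → ℝ

/-- The feature `ℱ₁(x) = σ(W₁ x + b₁)`, with `σ` applied componentwise. -/
def GradeParams.feature {a b : ℕ} (P : GradeParams a b) (σ : ℝ → ℝ) (x : Fin a → ℝ) : Fin b → ℝ :=
  fun i => σ ((P.W₁.mulVec x + P.b₁) i)

/-- The network `𝒩₂(x) = W₂ σ(W₁ x + b₁) + b₂`. -/
def GradeParams.net {a b : ℕ} (P : GradeParams a b) (σ : ℝ → ℝ) (x : Fin a → ℝ) : Fin 2 → ℝ :=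
  P.W₂.mulVec (P.feature σ x) + P.b₂

/-- `(𝒯 v)(s) = v₁(s) + i v₂(s)`. -/
def toComplex (v : ℝ → Fin 2 → ℝ) (s : ℝ) : ℂ := (v s 0 : ℂ) + Complex.I * (v s 1 : ℂ)

/-- Input dimensions: `d l` is the width of the hidden layer of grade `l + 1`. Grade 1 takes the
scalar `s` as its input and grade `l + 1` takes the feature of grade `l`. -/
def width (d : ℕ → ℕ) : ℕ → ℕ
  | 0 => 1
  | l + 1 => d l

/-- A choice of parameters for every grade; `θ l` are the parameters of grade `l + 1`. -/
abbrev Params (d : ℕ → ℕ) : Type := ∀ l : ℕ, GradeParams (width d l) (width d (l + 1))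

/-- The feature `g_l` of grade `l`; `g_0(s) = s` is the input of grade 1. -/
def feature (σ : ℝ → ℝ) {d : ℕ → ℕ} (θ : Params d) : (l : ℕ) → ℝ → Fin (width d l) → ℝ
  | 0 => fun s _ => s
  | l + 1 => fun s => (θ l).feature σ (feature σ θ l s)

/-- `𝒯 𝒩₂(P; g(·))`. -/
def gradeOutput (σ : ℝ → ℝ) {a b : ℕ} (g : ℝ → Fin a → ℝ) (P : GradeParams a b) : ℝ → ℂ :=
  toComplex fun s => P.net σ (g s)

/-- The error function of one grade with parameters `P`, where `e` is the error left by the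
previous grade and `g` its feature: `e - (ℐ - 𝒦_p) 𝒯 𝒩₂(P; g(·))`. -/
def gradeError (K : ℝ → ℝ → ℂ) (κ : ℝ) (p : ℕ) (σ : ℝ → ℝ) {a b : ℕ} (e : ℝ → ℂ)
    (g : ℝ → Fin a → ℝ) (P : GradeParams a b) (s : ℝ) : ℂ :=
  e s - (gradeOutput σ g P s - quadOp K κ p (gradeOutput σ g P) s)

/-- The error `e_l` of grade `l` for the parameters `θ`; before grade 1 it is the right-hand side
`f`. -/
def gradeErr (K : ℝ → ℝ → ℂ) (κ : ℝ) (p : ℕ) (f : ℝ → ℂ) (σ : ℝ → ℝ) {d : ℕ → ℕ}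
    (θ : Params d) : ℕ → ℝ → ℂ
  | 0 => f
  | l + 1 => gradeError K κ p σ (gradeErr K κ p f σ θ l) (feature σ θ l) (θ l)

/-- The approximate solution `y_l = ∑_{j=1}^l 𝒯 f_j` after `l` grades, where
`f_j = 𝒩₂(θ_j; g_{j-1}(·))`. -/
def approx (σ : ℝ → ℝ) {d : ℕ → ℕ} (θ : Params d) (l : ℕ) (s : ℝ) : ℂ :=
  ∑ j ∈ Finset.range l, gradeOutput σ (feature σ θ j) (θ j) s

/-- The tolerance `ε / (2 ‖M_κ⁻¹‖₂)` for the training error. -/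
def tolerance (K : ℝ → ℝ → ℂ) (κ : ℝ) (p q : ℕ) (ε : ℝ) : ℝ :=
  ε / (2 * specNorm (matM K κ p q)⁻¹)

/-- The adaptive algorithm, with at most `L` grades, trains the parameters `θ` and terminates at
grade `lstar`: every trained grade minimizes its squared training error, the loop condition
`l < L` and `‖e_l‖_N > ε / (2 ‖M_κ⁻¹‖₂)` holds at each `l < lstar` and fails at `lstar`. -/
structure TerminatesAt (K : ℝ → ℝ → ℂ) (κ : ℝ) (p q : ℕ) (f : ℝ → ℂ) (σ : ℝ → ℝ) (ε : ℝ) (L : ℕ)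
    {d : ℕ → ℕ} (θ : Params d) (lstar : ℕ) : Prop where
  one_le : 1 ≤ lstar
  isMin : ∀ l < lstar, ∀ P : GradeParams (width d l) (width d (l + 1)),
    discNorm p q (gradeErr K κ p f σ θ (l + 1)) ^ 2 ≤
      discNorm p q (gradeError K κ p σ (gradeErr K κ p f σ θ l) (feature σ θ l) P) ^ 2
  continues : ∀ l, 1 ≤ l → l < lstar →
    l < L ∧ tolerance K κ p q ε < discNorm p q (gradeErr K κ p f σ θ l)
  stops : ¬ (lstar < L ∧ tolerance K κ p q ε < discNorm p q (gradeErr K κ p f σ θ lstar))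

end

end AMGDL

namespace AMGDL

open MeasureTheory intervalIntegral

/-! ### Euler–Maclaurin summation for the trapezoidal rule -/

/-! Write `ỹ` for the computed solution. Since `𝒦_p` is linear, the grade errors telescope to `f -
(ℐ - 𝒦_p) ỹ` (`gradeErr_eq`), so on `I` the residual `(ℐ - 𝒦_p)(y - ỹ)` is the last grade error plus
the quadrature error `𝒦 y - 𝒦_p y` (`residual_eq`). Sampling at the collocation points turns `ℐ -
𝒦_p` into `M_κ` (`matM_mulVec`). Hence `‖y - ỹ‖_N` is at most `‖M_κ⁻¹‖₂` times the norm of the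
residual (`discNorm_le_specNorm_mul`), and the residual is at most twice the grade error once the
quadrature error is below it.

The analytic work is the quadrature bound. On either side of the kink `t = s` the integrand is a sum
of three terms `g(t) e^{i(b + ωt)}` with `|ω| ≤ 2κ`, whose `k`-th derivatives are at most `τ'
(3κ)^k`. Euler–Maclaurin summation of order `m` leaves boundary terms only at the ends of each side,
in total `O(h)`, and a remainder of size `(κh)^m` (`DerivChain.norm_sum_trapErr_le`). The one panel
containing `s` is estimated trivially, again by `O(h)`. -/

/-- For `k ≥ 2` the Fourier series of `B_k` gives `(2π)^k |B_k(x) / k!| ≤ 2 ζ(2) = π² / 3`; the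
cases `k = 0, 1` are direct. -/
theorem abs_bernoulliFun_div_factorial_le (k : ℕ) {x : ℝ} (hx : x ∈ Set.Icc (0 : ℝ) 1) :
    |bernoulliFun k x / (k.factorial : ℝ)| ≤ 2 * (1 / 4) ^ k := by
  rcases Nat.lt_or_ge k 2 with hk | hk
  · interval_cases k
    · norm_num [bernoulliFun_zero]
    · have := hx.1
      have := hx.2
      rw [bernoulliFun_one, Nat.factorial_one, Nat.cast_one, div_one, abs_le]
      constructor <;> linarith
  · have hs := hasSum_one_div_nat_pow_mul_fourier hk hx
    have h2 : HasSum (fun n : ℕ => 2 * ((1 : ℝ) / (n : ℝ) ^ 2)) (2 * (Real.pi ^ 2 / 6)) :=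
      hasSum_zeta_two.mul_left 2
    have hle : ‖(-(2 * Real.pi * Complex.I) ^ k / k.factorial * bernoulliFun k x : ℂ)‖
        ≤ 2 * (Real.pi ^ 2 / 6) := by
      refine hs.norm_le_of_bounded h2 fun n => ?_
      rw [norm_mul, mul_comm (2 : ℝ)]
      refine mul_le_mul ?_ ?_ (norm_nonneg _) (by positivity)
      · rw [norm_div, norm_one, norm_pow, Complex.norm_natCast]
        rcases Nat.eq_zero_or_pos n with rfl | hn
        · simp [show k ≠ 0 by omega]
        · have h1 : (1 : ℝ) ≤ n := by exact_mod_cast hn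
          exact one_div_le_one_div_of_le (by positivity) (pow_le_pow_right₀ h1 hk)
      · refine (norm_add_le _ _).trans ?_
        rw [norm_mul, norm_pow, norm_neg, norm_one, one_pow, one_mul]
        simp only [fourier_apply, Circle.norm_coe]
        norm_num
    have hpi := Real.pi_gt_three
    have heq : ‖(-(2 * Real.pi * Complex.I) ^ k / k.factorial * bernoulliFun k x : ℂ)‖
        = (2 * Real.pi) ^ k * |bernoulliFun k x / (k.factorial : ℝ)| := by
      rw [norm_mul, norm_div, norm_neg, norm_pow, norm_mul, norm_mul, Complex.norm_I,
        Complex.norm_natCast, Complex.norm_real, Complex.norm_real, abs_div, Real.norm_eq_abs,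
        Real.norm_eq_abs, abs_of_pos Real.pi_pos, Nat.abs_cast]
      norm_num
      ring
    rw [heq] at hle
    -- Two factors `2π` are kept exact so that `π²` cancels against `2 ζ(2)`; the others are only
    -- bounded below by `4`.
    have hpow : (2 * Real.pi) ^ 2 * 4 ^ (k - 2) ≤ (2 * Real.pi) ^ k := by
      obtain ⟨j, rfl⟩ := Nat.exists_eq_add_of_le hk
      rw [pow_add, Nat.add_sub_cancel_left]
      gcongr
      linarith
    have h4 : (4 : ℝ) ^ k = 16 * 4 ^ (k - 2) := by
      obtain ⟨j, rfl⟩ := Nat.exists_eq_add_of_le hk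
      rw [pow_add, Nat.add_sub_cancel_left]
      norm_num
    have h5 := (mul_le_mul_of_nonneg_right hpow
      (abs_nonneg (bernoulliFun k x / (k.factorial : ℝ)))).trans hle
    rw [one_div, inv_pow, ← div_eq_mul_inv, le_div_iff₀ (by positivity), h4]
    have h6 : (Real.pi ^ 2) * (4 * (4 ^ (k - 2) * |bernoulliFun k x / (k.factorial : ℝ)|))
        ≤ (Real.pi ^ 2) * (1 / 3) := by
      linarith
    have h7 := le_of_mul_le_mul_left h6 (by positivity)
    linarith

/-- `G 0, …, G m` are successive derivatives on `S`, the `k`-th of them bounded by `C A ^ k`. -/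
structure DerivChain (m : ℕ) (S : Set ℝ) (C A : ℝ) (G : ℕ → ℝ → ℂ) : Prop where
  hasDeriv : ∀ k < m, ∀ x ∈ S, HasDerivWithinAt (G k) (G (k + 1) x) S x
  bound : ∀ k ≤ m, ∀ x ∈ S, ‖G k x‖ ≤ C * A ^ k

theorem DerivChain.mono {m : ℕ} {S T : Set ℝ} {C A : ℝ} {G : ℕ → ℝ → ℂ}
    (hG : DerivChain m S C A G) (hT : T ⊆ S) : DerivChain m T C A G :=
  ⟨fun k hk x hx => (hG.hasDeriv k hk x (hT hx)).mono hT, fun k hk x hx => hG.bound k hk x (hT hx)⟩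

theorem DerivChain.continuousOn {m : ℕ} {S : Set ℝ} {C A : ℝ} {G : ℕ → ℝ → ℂ}
    (hG : DerivChain m S C A G) {k : ℕ} (hk : k < m) : ContinuousOn (G k) S :=
  fun x hx => (hG.hasDeriv k hk x hx).continuousWithinAt

/-- The top derivative `G m` need not be continuous. It is integrable because, on the open interval,
it is a derivative, hence measurable, and it is bounded. -/
theorem DerivChain.intervalIntegrable {m : ℕ} {a b C A : ℝ} (hab : a ≤ b) {G : ℕ → ℝ → ℂ}
    (hG : DerivChain m (Set.Icc a b) C A G) {k : ℕ} (hm : 1 ≤ m) (hk : k ≤ m) :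
    IntervalIntegrable (G k) volume a b := by
  rcases hk.lt_or_eq with hk' | rfl
  · exact (hG.continuousOn hk').intervalIntegrable_of_Icc hab
  · obtain ⟨j, rfl⟩ := Nat.exists_eq_add_of_le' hm
    rw [intervalIntegrable_iff_integrableOn_Ioo_of_le hab]
    have hd : IntegrableOn (deriv (G j)) (Set.Ioo a b) := by
      refine Measure.integrableOn_of_bounded (M := C * A ^ (j + 1)) (by simp)
        (aestronglyMeasurable_deriv _ _) ?_
      refine (ae_restrict_iff' measurableSet_Ioo).2 (Filter.Eventually.of_forall fun x hx => ?_)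
      rw [((hG.hasDeriv j (Nat.lt_succ_self j) x (Set.Ioo_subset_Icc_self hx)).hasDerivAt
        (Icc_mem_nhds hx.1 hx.2)).deriv]
      exact hG.bound _ le_rfl x (Set.Ioo_subset_Icc_self hx)
    refine hd.congr_fun (fun x hx => ?_) measurableSet_Ioo
    exact ((hG.hasDeriv j (Nat.lt_succ_self j) x (Set.Ioo_subset_Icc_self hx)).hasDerivAt
      (Icc_mem_nhds hx.1 hx.2)).deriv

/-- The error of the trapezoidal rule on `[a, a + h]`. -/
noncomputable def trapErr (F : ℝ → ℂ) (a h : ℝ) : ℂ :=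
  (∫ t in a..(a + h), F t) - (h / 2 : ℝ) * (F a + F (a + h))

/-- The Bernoulli polynomial `B_k / k!`, transplanted to `[a, a + h]`. -/
noncomputable def bernoulliWeight (a h : ℝ) (k : ℕ) (t : ℝ) : ℝ :=
  h ^ k * (bernoulliFun k ((t - a) / h) / (k.factorial : ℝ))

theorem hasDerivAt_bernoulliWeight {a h : ℝ} (hh : 0 < h) (k : ℕ) (t : ℝ) :
    HasDerivAt (bernoulliWeight a h (k + 1)) (bernoulliWeight a h k t) t := by
  have h1 : HasDerivAt (fun t : ℝ => (t - a) / h) (1 / h) t :=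
    ((hasDerivAt_id t).sub_const a).div_const h
  have h2 := (((hasDerivAt_bernoulliFun (k + 1) ((t - a) / h)).comp t h1).div_const
    ((k + 1).factorial : ℝ)).const_mul (h ^ (k + 1))
  refine h2.congr_deriv ?_
  rw [bernoulliWeight, Nat.factorial_succ, Nat.add_sub_cancel]
  have : (k.factorial : ℝ) ≠ 0 := by exact_mod_cast k.factorial_ne_zero
  push_cast
  field_simp
  ring

theorem abs_bernoulliWeight_le {a h : ℝ} (hh : 0 < h) (k : ℕ) {t : ℝ}
    (ht : t ∈ Set.Icc a (a + h)) : |bernoulliWeight a h k t| ≤ 2 * (h / 4) ^ k := by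
  have hx : (t - a) / h ∈ Set.Icc (0 : ℝ) 1 :=
    ⟨div_nonneg (by linarith [ht.1]) hh.le, (div_le_one hh).2 (by linarith [ht.2])⟩
  rw [bernoulliWeight, abs_mul, abs_of_pos (pow_pos hh k)]
  calc h ^ k * _ ≤ h ^ k * (2 * (1 / 4) ^ k) := by
        gcongr
        exact abs_bernoulliFun_div_factorial_le k hx
    _ = 2 * (h / 4) ^ k := by rw [div_pow, div_pow, one_pow]; ring

theorem bernoulliWeight_left (a h : ℝ) (k : ℕ) :
    bernoulliWeight a h k a = h ^ k * (bernoulli k / (k.factorial : ℝ)) := by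
  rw [bernoulliWeight, sub_self, zero_div, bernoulliFun_eval_zero]

theorem bernoulliWeight_right {a h : ℝ} (hh : 0 < h) {k : ℕ} (hk : k ≠ 1) :
    bernoulliWeight a h k (a + h) = h ^ k * (bernoulli k / (k.factorial : ℝ)) := by
  rw [bernoulliWeight, add_sub_cancel_left, div_self hh.ne', bernoulliFun_endpoints_eq_of_ne_one hk,
    bernoulliFun_eval_zero]

theorem DerivChain.integral_bernoulliWeight_mul {m : ℕ} {a h C A : ℝ} (hh : 0 < h)
    {G : ℕ → ℝ → ℂ} (hG : DerivChain m (Set.Icc a (a + h)) C A G) {k : ℕ} (hk : k < m) :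
    ∫ t in a..(a + h), (bernoulliWeight a h k t : ℂ) * G k t
      = bernoulliWeight a h (k + 1) (a + h) * G k (a + h) - bernoulliWeight a h (k + 1) a * G k a
        - ∫ t in a..(a + h), (bernoulliWeight a h (k + 1) t : ℂ) * G (k + 1) t := by
  have hab : a ≤ a + h := by linarith
  have hw : ∀ j t, HasDerivAt (fun t => (bernoulliWeight a h (j + 1) t : ℂ))
      (bernoulliWeight a h j t : ℂ) t := fun j t => (hasDerivAt_bernoulliWeight hh j t).ofReal_comp
  have hwc : Continuous fun t => (bernoulliWeight a h k t : ℂ) := by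
    unfold bernoulliWeight
    have := continuous_bernoulliFun k
    fun_prop
  have key := integral_mul_deriv_eq_deriv_mul_of_hasDerivWithinAt
    (u := fun t => (bernoulliWeight a h (k + 1) t : ℂ)) (v := G k)
    (u' := fun t => (bernoulliWeight a h k t : ℂ)) (v' := G (k + 1)) (a := a) (b := a + h)
    (fun x _ => (hw k x).hasDerivWithinAt)
    (fun x hx => by rw [Set.uIcc_of_le hab] at hx ⊢; exact hG.hasDeriv k hk x hx)
    (hwc.intervalIntegrable _ _) (hG.intervalIntegrable hab (by omega) hk)
  rw [key]
  ring

/-- Repeated integration by parts against the Bernoulli weights. The weight of index `1` takes the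
values `∓h/2` at the ends and produces the trapezoidal rule. Every later weight has equal values at
both ends, so its boundary term is a difference of `G k`, which telescopes over adjacent panels. -/
theorem DerivChain.trapErr_eq {m : ℕ} {a h C A : ℝ} (hh : 0 < h)
    {G : ℕ → ℝ → ℂ} (hG : DerivChain m (Set.Icc a (a + h)) C A G) {n : ℕ} (hn : 1 ≤ n)
    (hnm : n ≤ m) :
    trapErr (G 0) a h
      = ∑ k ∈ Finset.Ico 1 n, (-1) ^ k * ((h ^ (k + 1) * (bernoulli (k + 1) /
          ((k + 1).factorial : ℝ)) : ℝ) : ℂ) * (G k (a + h) - G k a)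
        + (-1) ^ n * ∫ t in a..(a + h), (bernoulliWeight a h n t : ℂ) * G n t := by
  induction n, hn using Nat.le_induction with
  | base =>
    have key := hG.integral_bernoulliWeight_mul hh (k := 0) (by omega)
    have h0 : ∀ t, bernoulliWeight a h 0 t = 1 := fun t => by
      simp [bernoulliWeight, bernoulliFun_zero]
    have h1 : bernoulliWeight a h (0 + 1) a = -(h / 2) := by
      simp [bernoulliWeight, bernoulliFun_one]; ring
    have h2 : bernoulliWeight a h (0 + 1) (a + h) = h / 2 := by
      simp [bernoulliWeight, bernoulliFun_one, hh.ne']; ring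
    rw [h1, h2] at key
    simp only [h0, Complex.ofReal_one, one_mul] at key
    rw [trapErr, key]
    simp only [zero_add, Finset.Ico_self, Finset.sum_empty, pow_one]
    push_cast
    ring
  | succ n hn ih =>
    rw [ih (by omega), hG.integral_bernoulliWeight_mul hh (k := n) (by omega),
      Finset.sum_Ico_succ_top hn, bernoulliWeight_left, bernoulliWeight_right hh (by omega)]
    ring

theorem sum_half_pow_le (n : ℕ) : ∑ k ∈ Finset.Ico 1 n, (1 / 2 : ℝ) ^ k ≤ 1 := by
  have h : ∀ n : ℕ, ∑ k ∈ Finset.Ico 1 (n + 1), (1 / 2 : ℝ) ^ k = 1 - (1 / 2) ^ n := by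
    intro n
    induction n with
    | zero => simp
    | succ n ih => rw [Finset.sum_Ico_succ_top (by omega), ih]; ring
  rcases n with _ | n
  · simp
  · rw [h]
    have : (0 : ℝ) ≤ (1 / 2) ^ n := by positivity
    linarith

/-- After telescoping, only the ends of the whole range contribute boundary terms; they are
dominated by a geometric series of ratio `A h / 4 ≤ 1/2`, independently of `n`. Only the remainder
integral grows with the length `n h`. -/
theorem DerivChain.norm_sum_trapErr_le {m : ℕ} (hm : 1 ≤ m) {a h C A r : ℝ} (hh : 0 < h)
    (hC : 0 ≤ C) (hA : 0 ≤ A) (hr : r ≤ 1) (hAr : A * h ≤ 2 * r) {n : ℕ}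
    {G : ℕ → ℝ → ℂ} (hG : DerivChain m (Set.Icc a (a + n * h)) C A G) :
    ‖∑ i ∈ Finset.range n, trapErr (G 0) (a + i * h) h‖ ≤ C * (h + 2 * r ^ m * (n * h)) := by
  have hr0 : 0 ≤ r := by nlinarith [mul_nonneg hA hh.le]
  have hsub : ∀ i ∈ Finset.range n,
      Set.Icc (a + i * h) (a + i * h + h) ⊆ Set.Icc a (a + n * h) := by
    intro i hi
    have h1 : ((i : ℝ) + 1) ≤ n := by exact_mod_cast Finset.mem_range.1 hi
    have h2 := mul_le_mul_of_nonneg_right h1 hh.le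
    have h3 : 0 ≤ (i : ℝ) * h := by positivity
    exact Set.Icc_subset_Icc (by linarith) (by linarith)
  set c : ℕ → ℝ := fun k => h ^ (k + 1) * (bernoulli (k + 1) / ((k + 1).factorial : ℝ)) with hc
  have hcle : ∀ k, |c k| ≤ 2 * (h / 4) ^ (k + 1) := fun k => by
    have := abs_bernoulliWeight_le hh (k + 1) (t := a) (a := a) ⟨le_rfl, by linarith⟩
    rwa [bernoulliWeight_left] at this
  have heq : ∑ i ∈ Finset.range n, trapErr (G 0) (a + i * h) h
      = ∑ k ∈ Finset.Ico 1 m, (-1) ^ k * (c k : ℂ) * (G k (a + n * h) - G k a)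
        + ∑ i ∈ Finset.range n, (-1) ^ m * ∫ t in (a + i * h)..(a + i * h + h),
            (bernoulliWeight (a + i * h) h m t : ℂ) * G m t := by
    rw [Finset.sum_congr rfl fun i hi =>
      (hG.mono (hsub i hi)).trapErr_eq hh hm le_rfl, Finset.sum_add_distrib, Finset.sum_comm]
    congr 1
    refine Finset.sum_congr rfl fun k _ => ?_
    rw [← Finset.mul_sum]
    congr 1
    -- The interior boundary terms cancel here.
    have := Finset.sum_range_sub (fun i : ℕ => G k (a + i * h)) n
    simp only [Nat.cast_zero, zero_mul, add_zero] at this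
    rw [← this]
    refine Finset.sum_congr rfl fun i _ => ?_
    push_cast
    ring_nf
  rw [heq]
  refine (norm_add_le _ _).trans ?_
  rw [mul_add]
  refine add_le_add ?_ ?_
  · calc ‖∑ k ∈ Finset.Ico 1 m, (-1) ^ k * (c k : ℂ) * (G k (a + n * h) - G k a)‖
        ≤ ∑ k ∈ Finset.Ico 1 m, C * h * (1 / 2) ^ k := by
          refine norm_sum_le_of_le _ fun k hk => ?_
          have hk' := Finset.mem_Ico.1 hk
          have hnn : a ≤ a + n * h := by have : 0 ≤ (n : ℝ) * h := by positivity
                                         linarith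
          have h1 : ‖G k (a + n * h) - G k a‖ ≤ 2 * (C * A ^ k) := by
            have := hG.bound k hk'.2.le _ (Set.right_mem_Icc.2 hnn)
            have := hG.bound k hk'.2.le _ (Set.left_mem_Icc.2 hnn)
            linarith [norm_sub_le (G k (a + n * h)) (G k a)]
          rw [norm_mul, norm_mul, norm_pow, norm_neg, norm_one, one_pow, one_mul,
            Complex.norm_real, Real.norm_eq_abs]
          calc |c k| * ‖G k (a + n * h) - G k a‖
              ≤ (2 * (h / 4) ^ (k + 1)) * (2 * (C * A ^ k)) :=
                mul_le_mul (hcle k) h1 (norm_nonneg _) (by positivity)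
            _ = C * h * (A * h / 4) ^ k := by rw [pow_succ, div_pow, div_pow, mul_pow]; ring
            _ ≤ C * h * (1 / 2) ^ k := by
                refine mul_le_mul_of_nonneg_left (pow_le_pow_left₀ (by positivity) ?_ k)
                  (by positivity)
                linarith
      _ = C * h * ∑ k ∈ Finset.Ico 1 m, (1 / 2) ^ k := by rw [Finset.mul_sum]
      _ ≤ C * h := mul_le_of_le_one_right (by positivity) (sum_half_pow_le m)
  · calc _ ≤ ∑ i ∈ Finset.range n, (2 * (h / 4) ^ m * (C * A ^ m)) * h := by
          refine norm_sum_le_of_le _ fun i hi => ?_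
          rw [norm_mul, norm_pow, norm_neg, norm_one, one_pow, one_mul]
          refine (intervalIntegral.norm_integral_le_of_norm_le_const fun t ht => ?_).trans_eq
            (by rw [add_sub_cancel_left, abs_of_pos hh])
          rw [Set.uIoc_of_le (by linarith)] at ht
          rw [norm_mul, Complex.norm_real, Real.norm_eq_abs]
          have ht' := Set.Ioc_subset_Icc_self ht
          exact mul_le_mul (abs_bernoulliWeight_le hh m ht')
            (hG.bound m le_rfl t (hsub i hi ht')) (norm_nonneg _) (by positivity)
      _ = C * (2 * (A * h / 4) ^ m * (n * h)) := by
          rw [Finset.sum_const, Finset.card_range, nsmul_eq_mul, div_pow, div_pow, mul_pow]; ring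
      _ ≤ C * (2 * r ^ m * (n * h)) := by
          gcongr
          linarith

/-! ### Oscillatory integrands -/

/-- The `j`-th derivative of `(d/dt + iω) ^ k g`, where `g l` is the `l`-th derivative of `g 0`. -/
noncomputable def twistedDeriv (ω : ℝ) (g : ℕ → ℝ → ℂ) : ℕ → ℕ → ℝ → ℂ
  | 0, j => g j
  | k + 1, j => fun t => twistedDeriv ω g k (j + 1) t + Complex.I * ω * twistedDeriv ω g k j t

theorem DerivChain.hasDeriv_twistedDeriv {m : ℕ} {S : Set ℝ} {C : ℝ} {g : ℕ → ℝ → ℂ}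
    (hg : DerivChain m S C 1 g) (ω : ℝ) (k j : ℕ) (hkj : k + j < m) {x : ℝ} (hx : x ∈ S) :
    HasDerivWithinAt (twistedDeriv ω g k j) (twistedDeriv ω g k (j + 1) x) S x := by
  induction k generalizing j with
  | zero => exact hg.hasDeriv j (by omega) x hx
  | succ k ih => exact (ih (j + 1) (by omega)).add ((ih j (by omega)).const_mul _)

/-- All derivatives of `g` share the bound `C`, so each application of `d/dt + iω` costs at most a
factor `1 + |ω|`. -/
theorem DerivChain.norm_twistedDeriv_le {m : ℕ} {S : Set ℝ} {C : ℝ} {g : ℕ → ℝ → ℂ}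
    (hg : DerivChain m S C 1 g) (ω : ℝ) (k j : ℕ) (hkj : k + j ≤ m) {x : ℝ} (hx : x ∈ S) :
    ‖twistedDeriv ω g k j x‖ ≤ C * (1 + |ω|) ^ k := by
  induction k generalizing j with
  | zero => simpa [twistedDeriv] using hg.bound j (by omega) x hx
  | succ k ih =>
    refine (norm_add_le _ _).trans ?_
    rw [norm_mul, norm_mul, Complex.norm_I, one_mul, Complex.norm_real, Real.norm_eq_abs]
    calc _ ≤ C * (1 + |ω|) ^ k + |ω| * (C * (1 + |ω|) ^ k) := by
          gcongr
          · exact ih (j + 1) (by omega)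
          · exact ih j (by omega)
      _ = C * (1 + |ω|) ^ (k + 1) := by ring

theorem norm_exp_I_mul_ofReal (x : ℝ) : ‖Complex.exp (Complex.I * (x : ℂ))‖ = 1 := by
  rw [mul_comm, Complex.norm_exp_ofReal_mul_I]

/-- Differentiating `g e^{i(b + ωt)}` amounts to applying `d/dt + iω` to the amplitude `g`, and the
exponential has modulus one. -/
theorem DerivChain.mul_exp {m : ℕ} {S : Set ℝ} {C A : ℝ} (hC : 0 ≤ C) {g : ℕ → ℝ → ℂ}
    (hg : DerivChain m S C 1 g) {ω : ℝ} (hω : 1 + |ω| ≤ A) (b : ℝ) :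
    DerivChain m S C A
      (fun k t => twistedDeriv ω g k 0 t * Complex.exp (Complex.I * ((b + ω * t : ℝ) : ℂ))) := by
  refine ⟨fun k hk x hx => ?_, fun k hk x hx => ?_⟩
  · have h1 : HasDerivAt (fun t : ℝ => ((b + ω * t : ℝ) : ℂ)) ((ω : ℝ) : ℂ) x := by
      have : HasDerivAt (fun t : ℝ => b + ω * t) ω x := by
        simpa using ((hasDerivAt_id x).const_mul ω).const_add b
      exact this.ofReal_comp
    have h2 := (h1.const_mul Complex.I).cexp
    refine ((hg.hasDeriv_twistedDeriv ω k 0 (by omega) hx).mul h2.hasDerivWithinAt).congr_deriv ?_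
    simp only [twistedDeriv]
    ring
  · rw [norm_mul, norm_exp_I_mul_ofReal, mul_one]
    refine (hg.norm_twistedDeriv_le ω k 0 (by omega) hx).trans ?_
    gcongr

theorem DerivBound.derivChain {m : ℕ} {C : ℝ} {g : ℝ → ℂ} (hg : DerivBound m C g) :
    DerivChain m interval C 1 (fun l => iteratedDerivWithin l g interval) := by
  refine ⟨fun k hk x hx => ?_, fun k hk x hx => ?_⟩
  · have := (hg.1 k hk x hx).hasDerivWithinAt
    simpa only [iteratedDerivWithin_succ] using this
  · simpa using hg.2 k hk x hx

theorem trapErr_congr {F G : ℝ → ℂ} {a h : ℝ} (hh : 0 ≤ h)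
    (hFG : ∀ t ∈ Set.Icc a (a + h), F t = G t) : trapErr F a h = trapErr G a h := by
  rw [trapErr, trapErr, hFG a ⟨le_rfl, by linarith⟩, hFG (a + h) ⟨by linarith, le_rfl⟩,
    integral_congr fun t ht => hFG t (by rwa [Set.uIcc_of_le (by linarith)] at ht)]

theorem trapErr_sum {ι : Type*} (s : Finset ι) {G : ι → ℝ → ℂ} {a h : ℝ}
    (hG : ∀ j ∈ s, IntervalIntegrable (G j) volume a (a + h)) :
    trapErr (fun t => ∑ j ∈ s, G j t) a h = ∑ j ∈ s, trapErr (G j) a h := by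
  simp only [trapErr]
  rw [integral_finsetSum hG, Finset.sum_sub_distrib, ← Finset.mul_sum, Finset.sum_add_distrib]

/-- A bound without any smoothness, for the panel containing the kink and for the case `m = 0`. -/
theorem norm_trapErr_le {F : ℝ → ℂ} {a h D : ℝ} (hh : 0 ≤ h)
    (hF : ∀ t ∈ Set.Icc a (a + h), ‖F t‖ ≤ D) : ‖trapErr F a h‖ ≤ 2 * D * h := by
  have h1 : ‖∫ t in a..(a + h), F t‖ ≤ D * h := by
    refine (intervalIntegral.norm_integral_le_of_norm_le_const (C := D) fun t ht => ?_).trans_eq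
      (by rw [add_sub_cancel_left, abs_of_nonneg hh])
    rw [Set.uIoc_of_le (by linarith)] at ht
    exact hF t (Set.Ioc_subset_Icc_self ht)
  have h2 : ‖((h / 2 : ℝ) : ℂ) * (F a + F (a + h))‖ ≤ (h / 2) * (D + D) := by
    rw [norm_mul, Complex.norm_real, Real.norm_eq_abs, abs_of_nonneg (by linarith)]
    have := hF a ⟨le_rfl, by linarith⟩
    have := hF (a + h) ⟨by linarith, le_rfl⟩
    gcongr
    exact (norm_add_le _ _).trans (by linarith)
  refine (norm_sub_le _ _).trans ?_
  linarith

/-- Trapezoidal rule for a sum of oscillatory functions with frequencies of modulus at most `2κ`,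
on a range of `n` panels contained in `[-1, 1]`. -/
theorem norm_sum_trapErr_osc_le {m : ℕ} (hm : 1 ≤ m) {C κ h r a : ℝ} (hC : 0 ≤ C) (hκ : 1 ≤ κ)
    (hh : 0 < h) (hr : r ≤ 1) (hAr : 3 * κ * h ≤ 2 * r) {n : ℕ} (ha : -1 ≤ a)
    (han : a + n * h ≤ 1) {g : Fin 3 → ℝ → ℂ} (hg : ∀ l, DerivBound m C (g l)) (ω : Fin 3 → ℝ)
    (hω : ∀ l, |ω l| ≤ 2 * κ) (b : ℝ) {F : ℝ → ℂ}
    (hF : ∀ t ∈ Set.Icc a (a + n * h),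
      F t = ∑ l, g l t * Complex.exp (Complex.I * ((b + ω l * t : ℝ) : ℂ))) :
    ‖∑ i ∈ Finset.range n, trapErr F (a + i * h) h‖ ≤ 3 * (C * (h + 2 * r ^ m * (n * h))) := by
  set G : Fin 3 → ℕ → ℝ → ℂ := fun l k t =>
    twistedDeriv (ω l) (fun j => iteratedDerivWithin j (g l) interval) k 0 t *
      Complex.exp (Complex.I * ((b + ω l * t : ℝ) : ℂ)) with hGdef
  -- The factor is `1 + |ω| ≤ 1 + 2κ ≤ 3κ`, by `κ ≥ 1`.
  have hG : ∀ l, DerivChain m (Set.Icc a (a + n * h)) C (3 * κ) (G l) := fun l =>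
    ((hg l).derivChain.mul_exp hC (by linarith [hω l]) b).mono (Set.Icc_subset_Icc ha han)
  have hG0 : ∀ l t, G l 0 t = g l t * Complex.exp (Complex.I * ((b + ω l * t : ℝ) : ℂ)) := by
    intro l t
    simp only [hGdef, twistedDeriv, iteratedDerivWithin_zero]
  have hsub : ∀ i ∈ Finset.range n,
      Set.Icc (a + i * h) (a + i * h + h) ⊆ Set.Icc a (a + n * h) := by
    intro i hi
    have h1 : ((i : ℝ) + 1) ≤ n := by exact_mod_cast Finset.mem_range.1 hi
    have h2 := mul_le_mul_of_nonneg_right h1 hh.le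
    have h3 : 0 ≤ (i : ℝ) * h := by positivity
    exact Set.Icc_subset_Icc (by linarith) (by linarith)
  have hsum : ∑ i ∈ Finset.range n, trapErr F (a + i * h) h
      = ∑ l, ∑ i ∈ Finset.range n, trapErr (G l 0) (a + i * h) h := by
    rw [Finset.sum_comm]
    refine Finset.sum_congr rfl fun i hi => ?_
    rw [← trapErr_sum _ fun l _ => ((hG l).mono (hsub i hi)).intervalIntegrable (by linarith) hm
      (Nat.zero_le m)]
    refine trapErr_congr hh.le fun t ht => ?_
    rw [hF t (hsub i hi ht)]
    exact Finset.sum_congr rfl fun l _ => (hG0 l t).symm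
  rw [hsum]
  refine (norm_sum_le_of_le _ fun l _ => (hG l).norm_sum_trapErr_le hm hh hC (by positivity) hr
    hAr).trans_eq ?_
  rw [Finset.sum_const, Finset.card_univ, Fintype.card_fin, nsmul_eq_mul]
  norm_num

/-! ### The quadrature error -/

theorem quadNode_eq (p j : ℕ) : quadNode p j = -1 + j * (2 / (p : ℝ)) := rfl

theorem quadNode_succ (p j : ℕ) : quadNode p (j + 1) = quadNode p j + 2 / (p : ℝ) := by
  rw [quadNode_eq, quadNode_eq]; push_cast; ring

theorem quadNode_self {p : ℕ} (hp : 0 < p) : quadNode p p = 1 := by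
  have : (p : ℝ) ≠ 0 := by exact_mod_cast hp.ne'
  rw [quadNode_eq]; field_simp; norm_num

theorem quadNode_mem {p j : ℕ} (hp : 0 < p) (hj : j ≤ p) : quadNode p j ∈ interval := by
  have h0 : (0 : ℝ) < p := by exact_mod_cast hp
  have h1 : (j : ℝ) ≤ p := by exact_mod_cast hj
  have h2 : (0 : ℝ) ≤ j * (2 / (p : ℝ)) := by positivity
  have h3 := mul_le_mul_of_nonneg_right h1 (by positivity : 0 ≤ 2 / (p : ℝ))
  have h4 : (p : ℝ) * (2 / p) = 2 := by field_simp
  rw [quadNode_eq]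
  exact ⟨by linarith, by linarith⟩

theorem Icc_quadNode_subset {p j : ℕ} (hj : j < p) :
    Set.Icc (quadNode p j) (quadNode p j + 2 / (p : ℝ)) ⊆ interval := by
  rw [← quadNode_succ]
  exact Set.Icc_subset_Icc (quadNode_mem (by omega) hj.le).1 (quadNode_mem (by omega) hj).2

theorem exists_quadNode_le {p : ℕ} (hp : 0 < p) {s : ℝ} (hs : s ∈ interval) :
    ∃ i < p, quadNode p i ≤ s ∧ s ≤ quadNode p (i + 1) := by
  have h0 : (0 : ℝ) < p := by exact_mod_cast hp
  have hex : ∃ i, s ≤ quadNode p (i + 1) :=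
    ⟨p - 1, by rw [Nat.sub_add_cancel hp, quadNode_self hp]; exact hs.2⟩
  classical
  refine ⟨Nat.find hex, ?_, ?_, Nat.find_spec hex⟩
  · have : Nat.find hex ≤ p - 1 :=
      Nat.find_min' hex (by rw [Nat.sub_add_cancel hp, quadNode_self hp]; exact hs.2)
    omega
  · rcases Nat.eq_zero_or_pos (Nat.find hex) with h | h
    · rw [h, quadNode_eq]; simpa using hs.1
    · have := Nat.find_min hex (Nat.sub_one_lt h.ne')
      rw [Nat.sub_add_cancel h] at this
      exact (not_le.1 this).le

theorem sum_range_add_succ {p : ℕ} (hp : 0 < p) (x : ℕ → ℂ) :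
    ∑ j ∈ Finset.range p, (x j + x (j + 1)) = x 0 + 2 * ∑ j ∈ Finset.Ico 1 p, x j + x p := by
  obtain ⟨n, rfl⟩ := Nat.exists_eq_succ_of_ne_zero hp.ne'
  clear hp
  induction n with
  | zero => simp
  | succ n ih =>
    rw [Finset.sum_range_succ, ih, Finset.sum_Ico_succ_top (b := n + 1) (by omega)]
    ring

theorem intOp_sub_quadOp {K : ℝ → ℝ → ℂ} {κ : ℝ} {p : ℕ} (hp : 0 < p) {y : ℝ → ℂ} {s : ℝ}
    (hF : ContinuousOn (fun t => oscKernel K κ s t * y t) interval) :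
    intOp K κ y s - quadOp K κ p y s
      = ∑ j ∈ Finset.range p,
          trapErr (fun t => oscKernel K κ s t * y t) (quadNode p j) (2 / p) := by
  have h2p : (0 : ℝ) ≤ 2 / p := by positivity
  have hint : intOp K κ y s = ∑ j ∈ Finset.range p, ∫ t in (quadNode p j)..(quadNode p (j + 1)),
      oscKernel K κ s t * y t := by
    rw [sum_integral_adjacent_intervals, quadNode_self hp, intOp]
    · simp [quadNode_eq]
    · intro j hj
      refine (hF.mono ?_).intervalIntegrable
      rw [quadNode_succ, Set.uIcc_of_le (by linarith)]
      exact Icc_quadNode_subset hj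
  rw [hint, quadOp, ← sum_range_add_succ hp fun j =>
    oscKernel K κ s (quadNode p j) * y (quadNode p j), Finset.mul_sum, ← Finset.sum_sub_distrib]
  refine Finset.sum_congr rfl fun j _ => ?_
  rw [trapErr, quadNode_succ]

theorem continuousOn_oscKernel_mul {K : ℝ → ℝ → ℂ} {κ : ℝ} {y : ℝ → ℂ} {s : ℝ}
    (hK : ContinuousOn (Function.uncurry K) (interval ×ˢ interval)) (hy : ContinuousOn y interval)
    (hs : s ∈ interval) : ContinuousOn (fun t => oscKernel K κ s t * y t) interval := by
  have h1 : ContinuousOn (fun t => K s t) interval :=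
    hK.comp (f := fun t : ℝ => (s, t)) (by fun_prop) fun t ht => ⟨hs, ht⟩
  have h2 : Continuous fun t : ℝ => Complex.exp (Complex.I * ((κ * |s - t| : ℝ) : ℂ)) := by
    fun_prop
  exact (h1.mul h2.continuousOn).mul hy

/-- The phase keeps `|s - t|`, so the formula holds on both sides of the kink; fixing the sign of `s
- t` makes each phase affine in `t`. -/
theorem oscKernel_mul_eq {K : ℝ → ℝ → ℂ} {κ τ : ℝ} {m : ℕ} {u : Fin 3 → ℝ → ℂ} {y : ℝ → ℂ}
    (hu : IsOscDecomposition κ m τ u y) (s : ℝ) {t : ℝ} (ht : t ∈ interval) :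
    oscKernel K κ s t * y t
      = ∑ l, (K s t * u l t) * Complex.exp (Complex.I *
          ((κ * |s - t| + (![0, κ, -κ] : Fin 3 → ℝ) l * t : ℝ) : ℂ)) := by
  have e0 : (![0, κ, -κ] : Fin 3 → ℝ) 0 = 0 := rfl
  have e1 : (![0, κ, -κ] : Fin 3 → ℝ) 1 = κ := rfl
  have e2 : (![0, κ, -κ] : Fin 3 → ℝ) 2 = -κ := rfl
  rw [oscKernel, hu.2 t ht, Fin.sum_univ_three, e0, e1, e2, zero_mul, neg_mul]
  simp only [Complex.ofReal_add, Complex.ofReal_neg, Complex.ofReal_zero, mul_add, mul_neg,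
    mul_zero, Complex.exp_add, Complex.exp_zero]
  ring

theorem norm_oscKernel_mul_le {K : ℝ → ℝ → ℂ} {κ τ τ' : ℝ} {m : ℕ} {u : Fin 3 → ℝ → ℂ} {y : ℝ → ℂ}
    (hu : IsOscDecomposition κ m τ u y)
    (hKu : ∀ j, ∀ t ∈ interval, DerivBound m τ' (fun s => K t s * u j s))
    {s t : ℝ} (hs : s ∈ interval) (ht : t ∈ interval) :
    ‖oscKernel K κ s t * y t‖ ≤ 3 * τ' := by
  rw [oscKernel_mul_eq hu s ht]
  refine (norm_sum_le_of_le (f := _) (n := fun _ => τ') _ fun l _ => ?_).trans_eq (by simp)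
  rw [norm_mul, norm_exp_I_mul_ofReal, mul_one]
  simpa using (hKu l s hs).2 0 (Nat.zero_le m) t ht

/-- With `h = 2 / p`, the smooth ranges left and right of `s` contribute `3 τ' h` each and the panel
containing `s` contributes `6 τ' h`. The remainders carry `6 τ' r^m` times a total length of at most
`2`. -/
theorem norm_intOp_sub_quadOp_le {K : ℝ → ℝ → ℂ}
    (hK : ContinuousOn (Function.uncurry K) (interval ×ˢ interval)) {y : ℝ → ℂ}
    (hy : ContinuousOn y interval) {κ : ℝ} (hκ : 1 ≤ κ) {p : ℕ} (hp : 0 < p) {m : ℕ} {τ : ℝ}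
    {u : Fin 3 → ℝ → ℂ} (hu : IsOscDecomposition κ m τ u y) {τ' : ℝ} (hτ' : 0 ≤ τ')
    (hKu : ∀ j, ∀ t ∈ interval, DerivBound m τ' (fun s => K t s * u j s))
    {r : ℝ} (hr : r ≤ 1) (hκr : 3 * κ * (2 / p) ≤ 2 * r) {s : ℝ} (hs : s ∈ interval) :
    ‖intOp K κ y s - quadOp K κ p y s‖ ≤ 12 * τ' * (2 / p) + 12 * τ' * r ^ m := by
  have hp0 : (0 : ℝ) < p := by exact_mod_cast hp
  have hh : (0 : ℝ) < 2 / p := by positivity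
  have hr0 : 0 ≤ r := by nlinarith [mul_pos (by linarith : 0 < 3 * κ) hh]
  have hph : (p : ℝ) * (2 / p) = 2 := by field_simp
  rw [intOp_sub_quadOp hp (continuousOn_oscKernel_mul hK hy hs)]
  set F : ℝ → ℂ := fun t => oscKernel K κ s t * y t with hF
  have hpanel : ∀ j < p, ‖trapErr F (quadNode p j) (2 / p)‖ ≤ 2 * (3 * τ') * (2 / p) :=
    fun j hj => norm_trapErr_le hh.le fun t ht =>
      norm_oscKernel_mul_le hu hKu hs (Icc_quadNode_subset hj ht)
  -- For `m = 0` only the supremum bound is available: `6 τ'` times the length `2` is already the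
  -- term `12 τ' r^0`.
  rcases Nat.eq_zero_or_pos m with rfl | hm
  · calc _ ≤ ∑ j ∈ Finset.range p, 2 * (3 * τ') * (2 / (p : ℝ)) :=
          norm_sum_le_of_le _ fun j hj => hpanel j (Finset.mem_range.1 hj)
      _ = 6 * τ' * ((p : ℝ) * (2 / p)) := by
          rw [Finset.sum_const, Finset.card_range, nsmul_eq_mul]; ring
      _ ≤ _ := by
          rw [hph, pow_zero]
          nlinarith [mul_nonneg hτ' hh.le]
  · obtain ⟨i, hip, his, hsi⟩ := exists_quadNode_le hp hs
    -- Now `p = (i + 1) + n`: `i` panels to the left, one panel containing `s`, and `n` to the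
    -- right.
    obtain ⟨n, rfl⟩ := Nat.exists_eq_add_of_le (Nat.succ_le_of_lt hip)
    set h : ℝ := 2 / ((i.succ + n : ℕ) : ℝ) with hhdef
    have hnode : ∀ j, quadNode (i.succ + n) j = -1 + j * h := fun j => rfl
    have hi2 : (i : ℝ) * h + h + n * h = 2 := by rw [← hph]; push_cast; ring
    have hnh : 0 ≤ (n : ℝ) * h := by positivity
    have hih : 0 ≤ (i : ℝ) * h := by positivity
    rw [hnode] at his hsi
    push_cast at hsi
    -- For `t ≤ s` the phase `κ(s - t)` shifts the frequencies `0, κ, -κ` by `-κ`; to the right of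
    -- `s` the shift is `+κ`.
    have hleft := norm_sum_trapErr_osc_le hm hτ' hκ hh hr hκr (n := i) (a := -1) le_rfl
      (by linarith) (fun l => hKu l s hs) ![-κ, 0, -(2 * κ)]
      (by intro l; fin_cases l <;> simp [abs_of_nonneg, abs_of_nonneg (zero_le_one.trans hκ)] <;>
          linarith)
      (κ * s) (F := F) (by
        intro t ht
        simp only [hF]
        rw [oscKernel_mul_eq hu s (Set.Icc_subset_Icc le_rfl (by linarith) ht),
          abs_of_nonneg (by linarith [ht.2])]
        refine Finset.sum_congr rfl fun l _ => ?_
        congr 4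
        fin_cases l <;> simp <;> ring)
    have hright := norm_sum_trapErr_osc_le hm hτ' hκ hh hr hκr (n := n) (a := -1 + (i + 1) * h)
      (by linarith) (by linarith) (fun l => hKu l s hs) ![κ, 2 * κ, 0]
      (by intro l; fin_cases l <;> simp [abs_of_nonneg, abs_of_nonneg (zero_le_one.trans hκ)] <;>
          linarith)
      (-(κ * s)) (F := F) (by
        intro t ht
        simp only [hF]
        rw [oscKernel_mul_eq hu s (Set.Icc_subset_Icc (by linarith) (by linarith) ht),
          abs_of_nonpos (by linarith [ht.1])]
        refine Finset.sum_congr rfl fun l _ => ?_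
        congr 4
        fin_cases l <;> simp <;> ring)
    have hmid := hpanel i hip
    rw [Finset.sum_range_add, Finset.sum_range_succ]
    have e1 : ∑ x ∈ Finset.range n, trapErr F (quadNode (i.succ + n) (i.succ + x)) h
        = ∑ x ∈ Finset.range n, trapErr F (-1 + (i + 1) * h + x * h) h := by
      refine Finset.sum_congr rfl fun x _ => ?_
      rw [hnode]; push_cast; congr 1; ring
    rw [e1]
    refine (norm_add₃_le).trans ((add_le_add_three hleft hmid hright).trans ?_)
    have hrm : 0 ≤ τ' * r ^ m := by positivity
    have hfin : τ' * r ^ m * ((i : ℝ) * h + h + n * h) = τ' * r ^ m * 2 := by rw [hi2]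
    have := mul_nonneg hrm hh.le
    nlinarith

theorem norm_intOp_sub_quadOp_le_quadBound {K : ℝ → ℝ → ℂ}
    (hK : ContinuousOn (Function.uncurry K) (interval ×ˢ interval)) {y : ℝ → ℂ}
    (hy : ContinuousOn y interval) {κ : ℝ} (hκ : 1 ≤ κ) {Γ β γ : ℝ} (hΓ : 0 ≤ Γ) (hβ : 1 ≤ β)
    (hγ : Γ + 3 ≤ γ) {m : ℕ} {τ : ℝ}
    {u : Fin 3 → ℝ → ℂ} (hu : IsOscDecomposition κ m τ u y) {τ' : ℝ} (hτ' : 0 ≤ τ')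
    (hKu : ∀ j, ∀ t ∈ interval, DerivBound m τ' (fun s => K t s * u j s)) {s : ℝ}
    (hs : s ∈ interval) :
    ‖intOp K κ y s - quadOp K κ (numNodes γ β κ) y s‖ ≤ quadBound τ' Γ γ β κ m := by
  have hκ0 : 0 < κ := by linarith
  have hγ0 : 0 < γ := by linarith
  set X : ℝ := κ ^ (β - 1) with hX
  have hX1 : 1 ≤ X := Real.one_le_rpow hκ (by linarith)
  have hXβ : κ ^ β = κ * X := by
    rw [hX, ← Real.rpow_one_add' hκ0.le (by linarith)]; congr 1; ring
  have hXm : κ ^ ((m : ℝ) * (β - 1)) = X ^ m := by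
    rw [mul_comm, Real.rpow_mul_natCast hκ0.le]
  have hpge : γ * κ ^ β ≤ (numNodes γ β κ : ℝ) := Nat.le_ceil _
  have hpos : 0 < γ * κ ^ β := by positivity
  have hp : 0 < numNodes γ β κ := by exact_mod_cast hpos.trans_le hpge
  have hh : 2 / (numNodes γ β κ : ℝ) ≤ 2 / (γ * κ ^ β) := by gcongr
  -- The choice `r = 3 / (γ κ^(β-1))` bounds `3κh/2`, and `r ≤ 1` because `γ ≥ Γ + 3 ≥ 3`.
  have hr : 3 / (γ * X) ≤ 1 := by
    rw [div_le_one (by positivity)]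
    nlinarith
  have hκr : 3 * κ * (2 / (numNodes γ β κ : ℝ)) ≤ 2 * (3 / (γ * X)) := by
    calc _ ≤ 3 * κ * (2 / (γ * κ ^ β)) := by gcongr
      _ = 2 * (3 / (γ * X)) := by rw [hXβ]; field_simp
  refine (norm_intOp_sub_quadOp_le hK hy hκ hp hu hτ' hKu hr hκr hs).trans ?_
  rw [quadBound, hXm]
  refine add_le_add ?_ ?_
  -- The argument yields the constants `120/5` and `60/5`, which leaves slack against `132/5` and
  -- `81/5`.
  · calc 12 * τ' * (2 / (numNodes γ β κ : ℝ)) ≤ 12 * τ' * (2 / (γ * κ ^ β)) := by gcongr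
      _ = 120 * τ' / (5 * γ * κ ^ β) := by field_simp; ring
      _ ≤ 132 * τ' / (5 * γ * κ ^ β) := by gcongr; norm_num
  · calc 12 * τ' * (3 / (γ * X)) ^ m = 60 * τ' * 3 ^ m / (5 * γ ^ m * X ^ m) := by
          rw [div_pow, mul_pow]; field_simp; ring
      _ ≤ 81 * τ' * (Γ + 3) ^ m / (5 * γ ^ m * X ^ m) := by
          gcongr
          · norm_num
          · linarith

/-! ### The linear system -/

theorem quadOp_sub (K : ℝ → ℝ → ℂ) (κ : ℝ) (p : ℕ) (F G : ℝ → ℂ) (s : ℝ) :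
    quadOp K κ p (fun t => F t - G t) s = quadOp K κ p F s - quadOp K κ p G s := by
  simp only [quadOp, mul_sub, Finset.sum_sub_distrib]
  ring

theorem quadOp_add (K : ℝ → ℝ → ℂ) (κ : ℝ) (p : ℕ) (F G : ℝ → ℂ) (s : ℝ) :
    quadOp K κ p (fun t => F t + G t) s = quadOp K κ p F s + quadOp K κ p G s := by
  simp only [quadOp, mul_add, Finset.sum_add_distrib]
  ring

theorem quadOp_zero (K : ℝ → ℝ → ℂ) (κ : ℝ) (p : ℕ) (s : ℝ) :
    quadOp K κ p (fun _ => 0) s = 0 := by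
  simp [quadOp]

theorem gradeErr_eq (K : ℝ → ℝ → ℂ) (κ : ℝ) (p : ℕ) (f : ℝ → ℂ) (σ : ℝ → ℝ) {d : ℕ → ℕ}
    (θ : Params d) (l : ℕ) (s : ℝ) :
    gradeErr K κ p f σ θ l s = f s - (approx σ θ l s - quadOp K κ p (approx σ θ l) s) := by
  induction l with
  | zero =>
    have : approx σ θ 0 = fun _ => 0 := by ext; simp [approx]
    rw [this, quadOp_zero, gradeErr]
    ring
  | succ l ih =>
    have : approx σ θ (l + 1)
        = fun t => approx σ θ l t + gradeOutput σ (feature σ θ l) (θ l) t := by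
      ext; simp [approx, Finset.sum_range_succ]
    rw [this, quadOp_add, gradeErr, gradeError, ih]
    ring

theorem collPoint_eq (p q : ℕ) (j : Fin (numColl p q)) :
    collPoint p q j = -1 + 2 * (j : ℝ) / ((p : ℝ) * q) := by
  rw [collPoint]
  simp [numColl]

theorem collPoint_mem {p q : ℕ} (hp : 0 < p) (hq : 0 < q) (j : Fin (numColl p q)) :
    collPoint p q j ∈ interval := by
  have hp0 : (0 : ℝ) < p := by exact_mod_cast hp
  have hq0 : (0 : ℝ) < q := by exact_mod_cast hq
  have hj : (j : ℝ) ≤ (p : ℝ) * q := by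
    have hj' : (j : ℕ) ≤ p * q := Nat.lt_succ_iff.1 j.2
    exact_mod_cast hj'
  have h1 : 2 * (j : ℝ) / ((p : ℝ) * q) ≤ 2 := by
    rw [div_le_iff₀ (by positivity)]; linarith
  have h2 : 0 ≤ 2 * (j : ℝ) / ((p : ℝ) * q) := by positivity
  rw [collPoint_eq]
  exact ⟨by linarith, by linarith⟩

/-- The collocation points have constant spacing `2 / (pq)`, so the phase is `|j - l|` times the
argument `2κ / (qp)` of `ω_κ`. -/
theorem oscKernel_collPoint (K : ℝ → ℝ → ℂ) (κ : ℝ) {p q : ℕ} (hp : 0 < p) (hq : 0 < q)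
    (j l : Fin (numColl p q)) :
    oscKernel K κ (collPoint p q j) (collPoint p q l)
      = K (collPoint p q j) (collPoint p q l) * omega κ p q ^ ((j : ℤ) - (l : ℤ)).natAbs := by
  have hp0 : (0 : ℝ) < p := by exact_mod_cast hp
  have hq0 : (0 : ℝ) < q := by exact_mod_cast hq
  rw [oscKernel, omega, ← Complex.exp_nat_mul]
  congr 2
  have h1 : ((((j : ℤ) - (l : ℤ)).natAbs : ℕ) : ℝ) = |(j : ℝ) - (l : ℝ)| := by
    rw [Nat.cast_natAbs]; push_cast; rfl
  have h2 : |collPoint p q j - collPoint p q l| = 2 / ((p : ℝ) * q) * |(j : ℝ) - (l : ℝ)| := by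
    have hc : 0 < 2 / ((p : ℝ) * q) := by positivity
    have hsub : collPoint p q j - collPoint p q l = 2 / ((p : ℝ) * q) * ((j : ℝ) - l) := by
      rw [collPoint_eq, collPoint_eq]; ring
    rw [hsub, abs_mul, abs_of_pos hc]
  rw [h2, ← h1]
  push_cast
  ring

/-- The index `d q` of the quadrature node `s_d` among the collocation points. -/
def nodeIndex {p : ℕ} (q : ℕ) {d : ℕ} (hd : d ≤ p) : Fin (numColl p q) :=
  ⟨d * q, Nat.lt_succ_of_le (Nat.mul_le_mul_right q hd)⟩

theorem collPoint_nodeIndex {p q : ℕ} (hq : 0 < q) {d : ℕ} (hd : d ≤ p) :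
    collPoint p q (nodeIndex q hd) = quadNode p d := by
  have hq0 : (q : ℝ) ≠ 0 := by exact_mod_cast hq.ne'
  rw [collPoint_eq, quadNode, nodeIndex]
  push_cast
  congr 1
  rw [← mul_assoc, mul_div_mul_right _ _ hq0]
  ring

theorem sum_matB_mul (K : ℝ → ℝ → ℂ) (κ : ℝ) {p q : ℕ} (hp : 0 < p) (hq : 0 < q) (F : ℝ → ℂ)
    (j : Fin (numColl p q)) :
    ∑ l, matB K κ p q j l * F (collPoint p q l)
      = oscKernel K κ (collPoint p q j) (quadNode p 0) * F (quadNode p 0)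
        + 2 * ∑ d ∈ Finset.Ico 1 p,
            oscKernel K κ (collPoint p q j) (quadNode p d) * F (quadNode p d)
        + oscKernel K κ (collPoint p q j) (quadNode p p) * F (quadNode p p) := by
  classical
  set Φ : ℝ → ℂ := fun t => oscKernel K κ (collPoint p q j) t * F t with hΦ
  have hpq : 0 < p * q := Nat.mul_pos hp hq
  -- Each entry splits into indicators of the index sets `{0}`, `{d q : 1 ≤ d < p}` and `{p q}`,
  -- disjoint because `0 < d q < p q`. Each indicator then selects one quadrature node in the sum
  -- over `l`.
  have hterm : ∀ l : Fin (numColl p q), matB K κ p q j l * F (collPoint p q l)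
      = (if l = nodeIndex q (Nat.zero_le p) then Φ (collPoint p q l) else 0)
        + (∑ d ∈ Finset.Ico 1 p, if (l : ℕ) = d * q then 2 * Φ (collPoint p q l) else 0)
        + (if l = nodeIndex q (le_refl p) then Φ (collPoint p q l) else 0) := by
    intro l
    have e0 : l = nodeIndex q (Nat.zero_le p) ↔ (l : ℕ) = 0 := by
      rw [Fin.ext_iff, nodeIndex]; simp
    have e1 : l = nodeIndex q (le_refl p) ↔ (l : ℕ) = p * q := by
      rw [Fin.ext_iff, nodeIndex]
    have hN : numColl p q - 1 = p * q := rfl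
    simp only [e0, e1, matB, Matrix.of_apply, hN, hΦ, oscKernel_collPoint K κ hp hq]
    have hne : ∀ d ∈ Finset.Ico 1 p, 0 < d * q ∧ d * q < p * q := fun d hd =>
      ⟨Nat.mul_pos (Finset.mem_Ico.1 hd).1 hq,
        Nat.mul_lt_mul_of_pos_right (Finset.mem_Ico.1 hd).2 hq⟩
    by_cases h : (l : ℕ) = 0 ∨ (l : ℕ) = p * q
    · rw [if_pos h, Finset.sum_eq_zero fun d hd => if_neg (by have := hne d hd; omega)]
      rcases h with h | h
      · rw [if_pos h, if_neg (by omega)]; ring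
      · rw [if_pos h, if_neg (by omega)]; ring
    · rw [if_neg h, if_neg (fun h' => h (Or.inl h')), if_neg (fun h' => h (Or.inr h'))]
      by_cases hex : ∃ d ∈ Finset.Ico 1 p, (l : ℕ) = d * q
      · rw [if_pos hex]
        obtain ⟨d, hd, hl⟩ := hex
        rw [Finset.sum_eq_single_of_mem d hd fun e _ hed => if_neg fun h' =>
          hed (Nat.eq_of_mul_eq_mul_right hq (h'.symm.trans hl)), if_pos hl]
        ring
      · rw [if_neg hex, Finset.sum_eq_zero fun d hd => if_neg fun h' => hex ⟨d, hd, h'⟩]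
        ring
  rw [Finset.sum_congr rfl fun l _ => hterm l, Finset.sum_add_distrib, Finset.sum_add_distrib,
    Finset.sum_ite_eq' Finset.univ, Finset.sum_ite_eq' Finset.univ, if_pos (Finset.mem_univ _),
    if_pos (Finset.mem_univ _), collPoint_nodeIndex hq, collPoint_nodeIndex hq, Finset.sum_comm,
    Finset.mul_sum]
  congr 2
  refine Finset.sum_congr rfl fun d hd => ?_
  have hdp := (Finset.mem_Ico.1 hd).2.le
  have e : ∀ l : Fin (numColl p q), (l : ℕ) = d * q ↔ l = nodeIndex q hdp := fun l => by
    rw [Fin.ext_iff, nodeIndex]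
  simp only [e]
  rw [Finset.sum_ite_eq' Finset.univ, if_pos (Finset.mem_univ _), collPoint_nodeIndex hq]

theorem matM_mulVec (K : ℝ → ℝ → ℂ) (κ : ℝ) {p q : ℕ} (hp : 0 < p) (hq : 0 < q) (F : ℝ → ℂ)
    (j : Fin (numColl p q)) :
    (matM K κ p q).mulVec (fun l => F (collPoint p q l)) j
      = F (collPoint p q j) - quadOp K κ p F (collPoint p q j) := by
  rw [matM, Matrix.sub_mulVec, Matrix.one_mulVec, Matrix.smul_mulVec, Pi.sub_apply, Pi.smul_apply,
    Matrix.mulVec, dotProduct, sum_matB_mul K κ hp hq, quadOp, smul_eq_mul]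
  congr 2
  push_cast
  ring

/-! ### The discrete norm, stability and the residual -/

theorem discNorm_eq (p q : ℕ) (g : ℝ → ℂ) :
    discNorm p q g = Real.sqrt (1 / (numColl p q : ℝ)) *
      ‖(WithLp.toLp 2 (fun j => g (collPoint p q j)) : EuclideanSpace ℂ (Fin (numColl p q)))‖ := by
  rw [discNorm, EuclideanSpace.norm_eq, Real.sqrt_mul (by positivity)]

theorem discNorm_add_le (p q : ℕ) (g h : ℝ → ℂ) :
    discNorm p q (fun s => g s + h s) ≤ discNorm p q g + discNorm p q h := by
  rw [discNorm_eq, discNorm_eq, discNorm_eq, ← mul_add]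
  refine mul_le_mul_of_nonneg_left ?_ (Real.sqrt_nonneg _)
  exact norm_add_le
    (WithLp.toLp 2 (fun j => g (collPoint p q j)) : EuclideanSpace ℂ (Fin (numColl p q)))
    (WithLp.toLp 2 (fun j => h (collPoint p q j)))

theorem discNorm_congr {p q : ℕ} {g h : ℝ → ℂ}
    (hgh : ∀ j, g (collPoint p q j) = h (collPoint p q j)) : discNorm p q g = discNorm p q h := by
  simp only [discNorm, hgh]

theorem discNorm_nonneg (p q : ℕ) (g : ℝ → ℂ) : 0 ≤ discNorm p q g := Real.sqrt_nonneg _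

theorem discNorm_le {p q : ℕ} {g : ℝ → ℂ} {D : ℝ} (hD : 0 ≤ D)
    (hg : ∀ j, ‖g (collPoint p q j)‖ ≤ D) : discNorm p q g ≤ D := by
  rw [discNorm]
  refine Real.sqrt_le_iff.2 ⟨hD, ?_⟩
  have hN : (0 : ℝ) < numColl p q := by rw [numColl]; positivity
  rw [one_div, inv_mul_le_iff₀ hN]
  refine (Finset.sum_le_card_nsmul _ _ (D ^ 2) fun j _ =>
    pow_le_pow_left₀ (norm_nonneg _) (hg j) 2).trans_eq ?_
  rw [Finset.card_univ, Fintype.card_fin, nsmul_eq_mul]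

/-- Stability: the sample vector satisfies `v = M⁻¹ (M v)`, and `M v` samples `(ℐ - 𝒦_p) F`. The
weight `1/N` is the same on both sides. -/
theorem discNorm_le_specNorm_mul {K : ℝ → ℝ → ℂ} {κ : ℝ} {p q : ℕ} (hp : 0 < p) (hq : 0 < q)
    (hM : IsUnit (matM K κ p q)) (F : ℝ → ℂ) :
    discNorm p q F
      ≤ specNorm (matM K κ p q)⁻¹ * discNorm p q (fun s => F s - quadOp K κ p F s) := by
  rw [discNorm_eq, discNorm_eq, mul_left_comm]
  refine mul_le_mul_of_nonneg_left ?_ (Real.sqrt_nonneg _)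
  set v : Fin (numColl p q) → ℂ := fun j => F (collPoint p q j) with hv
  have hMv : (fun j => F (collPoint p q j) - quadOp K κ p F (collPoint p q j))
      = (matM K κ p q).mulVec v := by
    ext j; exact (matM_mulVec K κ hp hq F j).symm
  have hinv : (WithLp.toLp 2 v : EuclideanSpace ℂ (Fin (numColl p q)))
      = Matrix.toEuclideanCLM (n := Fin (numColl p q)) (𝕜 := ℂ) (matM K κ p q)⁻¹
          (WithLp.toLp 2 ((matM K κ p q).mulVec v)) := by
    rw [Matrix.toEuclideanCLM_toLp, Matrix.mulVec_mulVec,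
      Matrix.nonsing_inv_mul _ ((Matrix.isUnit_iff_isUnit_det _).1 hM), Matrix.one_mulVec]
  rw [hMv, hinv]
  exact ContinuousLinearMap.le_opNorm _ _

theorem residual_eq {K : ℝ → ℝ → ℂ} {κ : ℝ} {f y : ℝ → ℂ} (hy : IsSolution K κ f y) (p : ℕ)
    (σ : ℝ → ℝ) {d : ℕ → ℕ} (θ : Params d) (l : ℕ) {s : ℝ} (hs : s ∈ interval) :
    (y s - approx σ θ l s) - quadOp K κ p (fun t => y t - approx σ θ l t) s
      = gradeErr K κ p f σ θ l s + (intOp K κ y s - quadOp K κ p y s) := by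
  rw [gradeErr_eq, quadOp_sub, ← hy.2 s hs]
  ring

end AMGDL

theorem theorem5
    (K : ℝ → ℝ → ℂ)
    (hK : ContinuousOn (Function.uncurry K) (AMGDL.interval ×ˢ AMGDL.interval))
    (f y : ℝ → ℂ) (hf : ContinuousOn f AMGDL.interval)
    (κ : ℝ) (hκ : 1 ≤ κ) (hy : AMGDL.IsSolution K κ f y)
    (Γ β γ : ℝ) (hΓ : 0 ≤ Γ) (hβ : 1 ≤ β) (hγ : Γ + 3 ≤ γ)
    (q : ℕ) (hq : 1 ≤ q)
    (p : ℕ) (hp : p = AMGDL.numNodes γ β κ)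
    (m : ℕ) (τ : ℝ) (hτ : 0 < τ) (u : Fin 3 → ℝ → ℂ)
    (hu : AMGDL.IsOscDecomposition κ m τ u y)
    (τ' : ℝ) (hτ' : 0 < τ')
    (hKu : ∀ j, ∀ t ∈ AMGDL.interval, AMGDL.DerivBound m τ' (fun s => K t s * u j s))
    (σ : ℝ → ℝ) (hσ : Continuous σ)
    (d : ℕ → ℕ) (hd : ∀ l, 0 < d l)
    (ε : ℝ) (hε : 0 < ε) (L : ℕ) (hL : 1 ≤ L)
    (hM : IsUnit (AMGDL.matM K κ p q))
    (θ : AMGDL.Params d) (lstar : ℕ)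
    (hterm : AMGDL.TerminatesAt K κ p q f σ ε L θ lstar)
    (htol : AMGDL.discNorm p q (AMGDL.gradeErr K κ p f σ θ lstar)
      ≤ ε / (2 * AMGDL.specNorm (AMGDL.matM K κ p q)⁻¹))
    (hquad : AMGDL.quadBound τ' Γ γ β κ m
      ≤ AMGDL.discNorm p q (AMGDL.gradeErr K κ p f σ θ lstar)) :
    AMGDL.discNorm p q (fun s => y s - AMGDL.approx σ θ lstar s) ≤ ε := by
  have hp0 : 0 < p := by
    rw [hp, AMGDL.numNodes, Nat.ceil_pos]
    exact mul_pos (by linarith) (Real.rpow_pos_of_pos (by linarith) _)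
  set e := AMGDL.discNorm p q (AMGDL.gradeErr K κ p f σ θ lstar) with he
  set S := AMGDL.specNorm (AMGDL.matM K κ p q)⁻¹ with hS
  have hS0 : 0 ≤ S := norm_nonneg _
  have he0 : 0 ≤ e := AMGDL.discNorm_nonneg _ _ _
  have hquadErr : AMGDL.discNorm p q
      (fun s => AMGDL.intOp K κ y s - AMGDL.quadOp K κ p y s) ≤ e := by
    refine AMGDL.discNorm_le he0 fun j => le_trans ?_ hquad
    have hmem := AMGDL.collPoint_mem hp0 hq j
    subst hp
    exact AMGDL.norm_intOp_sub_quadOp_le_quadBound hK hy.1 hκ hΓ hβ hγ hu hτ'.le hKu hmem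
  have hres : AMGDL.discNorm p q (fun s => (y s - AMGDL.approx σ θ lstar s)
      - AMGDL.quadOp K κ p (fun t => y t - AMGDL.approx σ θ lstar t) s) ≤ 2 * e := by
    -- The residual identity holds only on `I`, which suffices since the norm sees only collocation
    -- points.
    rw [AMGDL.discNorm_congr (h := fun s => AMGDL.gradeErr K κ p f σ θ lstar s
        + (AMGDL.intOp K κ y s - AMGDL.quadOp K κ p y s)) fun j =>
      AMGDL.residual_eq hy p σ θ lstar (AMGDL.collPoint_mem hp0 hq j)]
    exact (AMGDL.discNorm_add_le p q _ _).trans (by linarith)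
  refine (AMGDL.discNorm_le_specNorm_mul hp0 hq hM _).trans
    ((mul_le_mul_of_nonneg_left hres hS0).trans ?_)
  -- If `S = 0`, the quotient in `htol` is a division by zero and carries no information, but the
  -- bound `S * (2 * e)` vanishes.
  rcases hS0.eq_or_lt with h0 | h0
  · rw [← h0, zero_mul]
    exact hε.le
  · rw [le_div_iff₀ (by linarith)] at htol
    linarith
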